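/- **Setting.** A *stochastic game* $G=(V,\to,(V_\Box,V_\Diamond,V_\bigcirc),\mathit{Prob})$ consists of a finite or countably infinite set $V$ of vertices, an edge relation ${\to}\subseteq V\times V$ such that every vertex has at least one outgoing edge, a partition $(V_\Box,V_\Diamond,V_\bigcirc)$ of $V$, and an assignment $\mathit{Prob}$ of a positive probability distribution on the outgoing edges of $v$ to each $v\in V_\bigcirc$. It is *finitely branching* if every vertex has only finitely many successors. A *strategy* of player $\odot\in\{\Box,\Diamond\}$ is a function which to each word $wv$ with $w \in V^*$ and $v\in V_\odot$ assigns a probability distribution on the outgoing edges of $v$ (so strategies may be history-dependent and randomized). Let $\Sigma$ and $\Pi$ be the sets of all strategies of player $\Box$ and of player $\Diamond$. A pair $(\sigma,\pi)\in\Sigma\times\Pi$ determines a Markov chain $G(\sigma,\pi)$ whose states are the nonempty finite words over $V$ and which moves from $wu$ to $wuu'$, for each edge $u\to u'$, with the probability given to this edge by $\sigma(wu)$, $\pi(wu)$ or $\mathit{Prob}(u)$ according to whether $u\in V_\Box$, $u\in V_\Diamond$ or $u\in V_\bigcirc$. For $T\subseteq V$, let $\mathcal P_v^{\sigma,\pi}(\mathit{Reach}(T))$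 be the probability that a run of $G(\sigma,\pi)$ started in the one-letter word $v$ visits a word whose last letter is in $T$. A *(quantitative) reachability objective* is a pair $(T,{\succ}\varrho)$ with $T\subseteq V$, ${\succ}\in\{>,\geq\}$ and $\varrho\in[0,1]$. A strategy $\sigma\in\Sigma$ is *$(T,{\succ}\varrho)$-winning* in $v$ if $\mathcal P_v^{\sigma,\pi}(\mathit{Reach}(T))\succ\varrho$ for all $\pi\in\Pi$; a strategy $\pi\in\Pi$ is *$(T,{\not\succ}\varrho)$-winning* in $v$ if $\mathcal P_v^{\sigma,\pi}(\mathit{Reach}(T))\not\succ\varrho$ for all $\sigma\in\Sigma$. Let $[T]_\Box^{\succ\varrho}$ be the set of all $v\in V$ in which player $\Box$ has a $(T,{\succ}\varrho)$-winning strategy, and let $[T]_\Diamond^{\not\succ\varrho}$ be the set of all $v\in V$ in which player $\Diamond$ has a $(T,{\not\succ}\varrho)$-winning strategy. **Theorem (Determinacy).** Let $G$ be a finitely branching stochastic game and let $(T,{\succ}\varrho)$ be a reachability objective. Then $$V \;=\; [T]_\Box^{\succ\varrho}\;\uplus\;[T]_\Diamond^{\not\succ\varrho},$$ that is, every vertex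 belongs to exactly one of these two sets. -/

import Mathlib

/-! ### Markov chains

A Markov chain on a countable state space `M` is given by its transition probabilities
`p : M → PMF M`; the transition relation is `s → t` iff `p s t ≠ 0`, so that `p s` is a positive
probability distribution on the (nonempty) set of transitions going out of `s`. -/

section MarkovChain

variable {M : Type*} [MeasurableSpace M] [DiscreteMeasurableSpace M]

/-- The transition kernel of the Markov chain with transition probabilities `p`. -/
noncomputable def markovKernel (p : M → PMF M) : ProbabilityTheory.Kernel M M where
  toFun s := (p s).toMeasure
  measurable' := Measurable.of_discrete

instance markovKernel_isMarkovKernel (p : M → PMF M) :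
    ProbabilityTheory.IsMarkovKernel (markovKernel p) :=
  ⟨fun s => PMF.toMeasure.isProbabilityMeasure (p s)⟩

/-- The law of the next state given the states at the times `0, …, n`: it depends only on the
state at time `n`. -/
noncomputable def markovStep (p : M → PMF M) (n : ℕ) :
    ProbabilityTheory.Kernel (Finset.Iic n → M) M :=
  (markovKernel p).comap (fun x => x ⟨n, Finset.mem_Iic.2 le_rfl⟩) (measurable_pi_apply _)

instance markovStep_isMarkovKernel (p : M → PMF M) (n : ℕ) :
    ProbabilityTheory.IsMarkovKernel (markovStep p n) := by
  unfold markovStep; infer_instance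

/-- The probability measure on the infinite sequences of states (with the `σ`-algebra generated by
the cylinders) of the Markov chain `p` started in `s`. It is concentrated on the runs that start
in `s`. -/
noncomputable def markovMeasure (p : M → PMF M) (s : M) : MeasureTheory.Measure (ℕ → M) :=
  ProbabilityTheory.Kernel.traj (X := fun _ => M) (markovStep p) 0 (fun _ => s)

end MarkovChain

/-! ### Stochastic games -/

/-- The owner of a vertex: player `□`, player `◇`, or chance (`○`). -/
inductive VertexKind where
  | box
  | diamond
  | circle

/-- A stochastic game with set of vertices `V`. The partition `(V_□, V_◇, V_○)` of `V` is given
by the function `owner`. An edge going out of `v` is identified with its endpoint. -/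
structure StochasticGame (V : Type*) where
  /-- The edge relation. -/
  Edge : V → V → Prop
  /-- The edge relation is total. -/
  total : ∀ v, ∃ u, Edge v u
  /-- The partition of the vertices. -/
  owner : V → VertexKind
  /-- The probability assignment: a distribution on the outgoing edges of each vertex of `V_○`. -/
  prob : ∀ v, owner v = VertexKind.circle → PMF {u // Edge v u}
  /-- The assigned distributions are positive. -/
  prob_pos : ∀ v (hv : owner v = VertexKind.circle) (e : {u // Edge v u}), 0 < prob v hv e

/-- A nonempty finite word `wv` over `V`, where `w = past` and `v = last`. -/
@[ext]
structure History (V : Type*) where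
  /-- All letters but the last one. -/
  past : List V
  /-- The last letter. -/
  last : V

namespace History

instance {V : Type*} : MeasurableSpace (History V) := ⊤

instance {V : Type*} : DiscreteMeasurableSpace (History V) := ⟨fun _ => trivial⟩

/-- The word obtained by appending the letter `u` at the end of a nonempty word. -/
def snoc {V : Type*} (h : History V) (u : V) : History V := ⟨h.past ++ [h.last], u⟩

end History

namespace StochasticGame

variable {V : Type*} (G : StochasticGame V)

/-- Each vertex has only finitely many successors. -/
def FinitelyBranching : Prop := ∀ v, {u | G.Edge v u}.Finite

/-- A (history-dependent, randomized) strategy of the owner `k` (used for `k = box` and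
`k = diamond`): to each word `wv` whose last vertex `v` is owned by `k` it assigns a probability
distribution on the outgoing edges of `v`. -/
def Strategy (k : VertexKind) : Type _ :=
  ∀ (_w : List V) (v : V), G.owner v = k → PMF {u // G.Edge v u}

variable {G}

/-- The distribution on the outgoing edges of the last vertex of `h` under `σ` and `π`. -/
noncomputable def edgeDist (σ : G.Strategy .box) (π : G.Strategy .diamond) (h : History V) :
    PMF {u // G.Edge h.last u} :=
  match hk : G.owner h.last with
  | .box => σ h.past h.last hk
  | .diamond => π h.past h.last hk
  | .circle => G.prob h.last hk

/-- The play `G(σ, π)`: the Markov chain on the nonempty finite words over `V` which moves from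
`wu` to `wuu'` with the probability of the edge from `u` to `u'` after the history `wu`. -/
noncomputable def play (σ : G.Strategy .box) (π : G.Strategy .diamond) (h : History V) :
    PMF (History V) :=
  (edgeDist σ π h).map (fun u => h.snoc u.1)

/-- The probability that the play `G(σ, π)` started in the one-letter word `v` visits `T`, that is,
reaches some word whose last letter belongs to `T`. -/
noncomputable def reachProb (σ : G.Strategy .box) (π : G.Strategy .diamond) (v : V) (T : Set V) :
    ℝ :=
  (markovMeasure (play σ π) ⟨[], v⟩).real {ω | ∃ i, (ω i).last ∈ T}

/-- The comparison `≻ ∈ {>, ≥}` of a probability constraint. -/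
inductive Comparison where
  | gt
  | ge

/-- `x ≻ ϱ`. -/
def Comparison.Holds : Comparison → ℝ → ℝ → Prop
  | .gt, x, ϱ => x > ϱ
  | .ge, x, ϱ => x ≥ ϱ

/-- `σ` is `(T, ≻ϱ)`-winning in `v`. -/
def IsWinningBox (T : Set V) (c : Comparison) (ϱ : ℝ) (v : V) (σ : G.Strategy .box) : Prop :=
  ∀ π : G.Strategy .diamond, c.Holds (reachProb σ π v T) ϱ

/-- `π` is `(T, ⊁ϱ)`-winning in `v`. -/
def IsWinningDiamond (T : Set V) (c : Comparison) (ϱ : ℝ) (v : V) (π : G.Strategy .diamond) :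
    Prop :=
  ∀ σ : G.Strategy .box, ¬ c.Holds (reachProb σ π v T) ϱ

variable (G)

/-- The `(T, ≻ϱ)`-winning region of player `□`. -/
def winningRegionBox (T : Set V) (c : Comparison) (ϱ : ℝ) : Set V :=
  {v | ∃ σ : G.Strategy .box, IsWinningBox T c ϱ v σ}

/-- The `(T, ⊁ϱ)`-winning region of player `◇`. -/
def winningRegionDiamond (T : Set V) (c : Comparison) (ϱ : ℝ) : Set V :=
  {v | ∃ π : G.Strategy .diamond, IsWinningDiamond T c ϱ v π}

end StochasticGame

/-!
The argument works on histories. Probabilities are `ℝ≥0∞`-valued; the probability of reaching `T`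
after a history is the least solution of its one-step equation (`hitProb_le_of_superharmonic`), and
the Markov property identifies it with the probability in the path space (`markovMeasure_hits`).

Let `value` be the limit of the values of the games with finite horizon. Finite branching makes it a
solution of the Bellman equation, so `◇` keeps the reachability probability at most at the value by
always moving to a successor of minimal value (`reachFrom_le_value`), while `□` comes arbitrarily
close to the value by playing for a sufficiently long horizon
(`exists_lt_reachFrom_of_lt_value`). This decides every objective except `≥ ϱ` where `ϱ` is exactly
the value. There the claim is that `□` attains the value unless `◇` can keep the probability
strictly below it (`undercutRegion`).

Suppose `◇` cannot undercut the value. Let `◇` preserve the value and switch to an undercutting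
strategy as soon as one exists. As this does not undercut the value, some strategy of `□` attains
it, and in the resulting play neither a loss of value by `□` nor a visit to the undercut region has
positive probability (`exists_play_attaining_value`). Consequently `□` can stay outside that region
without losing value, and the game in which `□` is restricted to doing so and `◇` to preserving the
value still has the same value (`value_le_restrictedValue`). In the restricted game the value is a
martingale, so `□` can play in rounds, each of which attains half of the value of the history in
which it starts: after `j` rounds, all but the fraction `2⁻ʲ` of the original value is secured. If
`◇` leaves the restricted game, the value has increased and `□` can secure what it was before
(`exists_value_le_reachFrom`).
-/

open MeasureTheory ProbabilityTheory
open scoped ENNReal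

/-! ### Hitting probabilities of Markov chains -/

section Hitting

variable {M : Type*}

/-- The probability that the Markov chain `p` started in `s` visits `A` within `n` steps, given by
its one-step recursion. -/
noncomputable def hitWithin (p : M → PMF M) (A : Set M) : ℕ → M → ℝ≥0∞
  | 0, s => A.indicator 1 s
  | n + 1, s => open Classical in if s ∈ A then 1 else ∑' t, p s t * hitWithin p A n t

/-- The probability that the Markov chain `p` started in `s` ever visits `A`. -/
noncomputable def hitProb (p : M → PMF M) (A : Set M) (s : M) : ℝ≥0∞ :=
  ⨆ n, hitWithin p A n s

variable (p : M → PMF M) (A : Set M)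

lemma hitWithin_of_mem {s : M} (hs : s ∈ A) (n : ℕ) : hitWithin p A n s = 1 := by
  cases n <;> simp [hitWithin, hs]

lemma hitWithin_zero_of_notMem {s : M} (hs : s ∉ A) : hitWithin p A 0 s = 0 := by
  simp [hitWithin, hs]

lemma hitWithin_succ_of_notMem {s : M} (hs : s ∉ A) (n : ℕ) :
    hitWithin p A (n + 1) s = ∑' t, p s t * hitWithin p A n t := by
  simp [hitWithin, hs]

lemma hitWithin_le_succ (n : ℕ) (s : M) : hitWithin p A n s ≤ hitWithin p A (n + 1) s := by
  by_cases hs : s ∈ A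
  · simp [hitWithin_of_mem, hs]
  induction n generalizing s with
  | zero => simp [hitWithin_zero_of_notMem, hs]
  | succ n ih =>
    rw [hitWithin_succ_of_notMem p A hs, hitWithin_succ_of_notMem p A hs]
    refine ENNReal.tsum_le_tsum fun t => mul_le_mul_right ?_ _
    by_cases ht : t ∈ A
    · simp [hitWithin_of_mem, ht]
    · exact ih t ht

lemma hitWithin_mono (s : M) : Monotone fun n => hitWithin p A n s :=
  monotone_nat_of_le_succ fun n => hitWithin_le_succ p A n s

lemma hitProb_of_mem {s : M} (hs : s ∈ A) : hitProb p A s = 1 := by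
  simp [hitProb, hitWithin_of_mem p A hs]

lemma ENNReal.tsum_iSup_of_monotone {ι : Type*} {f : ι → ℕ → ℝ≥0∞} (hf : ∀ i, Monotone (f i)) :
    ∑' i, ⨆ n, f i n = ⨆ n, ∑' i, f i n := by
  simp only [ENNReal.tsum_eq_iSup_sum]
  rw [iSup_comm]
  exact iSup_congr fun s => ENNReal.finsetSum_iSup_of_monotone hf

lemma PMF.tsum_mul_iSup_of_monotone {ι : Type*} (q : PMF ι) {f : ℕ → ι → ℝ≥0∞}
    (hf : ∀ i, Monotone fun n => f n i) :
    ∑' i, q i * ⨆ n, f n i = ⨆ n, ∑' i, q i * f n i := by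
  simp only [ENNReal.mul_iSup]
  exact ENNReal.tsum_iSup_of_monotone fun i m n h => mul_le_mul_right (hf i h) _

lemma hitProb_of_notMem {s : M} (hs : s ∉ A) :
    hitProb p A s = ∑' t, p s t * hitProb p A t := by
  unfold hitProb
  rw [PMF.tsum_mul_iSup_of_monotone _ (hitWithin_mono p A),
    ← (hitWithin_mono p A s).iSup_nat_add 1]
  exact iSup_congr fun n => hitWithin_succ_of_notMem p A hs n

/-- The hitting probability is the least superharmonic function that is at least `1` on `A`. Both
the superharmonicity and the comparison are only needed on a set `S` that the chain does not
leave before it hits `A`. -/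
lemma hitProb_le_of_superharmonic (S : Set M) (f : M → ℝ≥0∞) (hA : ∀ s ∈ S, s ∈ A → 1 ≤ f s)
    (hS : ∀ s ∈ S, s ∉ A → ∀ t, p s t ≠ 0 → t ∈ S)
    (hf : ∀ s ∈ S, s ∉ A → ∑' t, p s t * f t ≤ f s) {s : M} (hs : s ∈ S) :
    hitProb p A s ≤ f s := by
  refine iSup_le fun n => ?_
  induction n generalizing s with
  | zero =>
    by_cases h : s ∈ A
    · rw [hitWithin_of_mem p A h]; exact hA s hs h
    · simp [hitWithin_zero_of_notMem p A h]
  | succ n ih =>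
    by_cases h : s ∈ A
    · rw [hitWithin_of_mem p A h]; exact hA s hs h
    rw [hitWithin_succ_of_notMem p A h]
    refine le_trans (ENNReal.tsum_le_tsum fun t => ?_) (hf s hs h)
    by_cases ht : p s t = 0
    · simp [ht]
    · exact mul_le_mul_right (ih (hS s hs h t ht)) _

lemma PMF.tsum_mul_le {ι : Type*} (q : PMF ι) {f : ι → ℝ≥0∞} {c : ℝ≥0∞}
    (h : ∀ i, q i ≠ 0 → f i ≤ c) : ∑' i, q i * f i ≤ c := by
  calc ∑' i, q i * f i ≤ ∑' i, q i * c := ENNReal.tsum_le_tsum fun i => by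
        by_cases hi : q i = 0
        · simp [hi]
        · exact mul_le_mul_right (h i hi) _
    _ = c := by rw [ENNReal.tsum_mul_right, q.tsum_coe, one_mul]

lemma PMF.le_tsum_mul {ι : Type*} (q : PMF ι) {f : ι → ℝ≥0∞} {c : ℝ≥0∞}
    (h : ∀ i, q i ≠ 0 → c ≤ f i) : c ≤ ∑' i, q i * f i := by
  calc c = ∑' i, q i * c := by rw [ENNReal.tsum_mul_right, q.tsum_coe, one_mul]
    _ ≤ _ := ENNReal.tsum_le_tsum fun i => by
        by_cases hi : q i = 0
        · simp [hi]
        · exact mul_le_mul_right (h i hi) _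

lemma PMF.tsum_pure_mul {ι : Type*} (i : ι) (f : ι → ℝ≥0∞) :
    ∑' j, PMF.pure i j * f j = f i := by
  rw [tsum_eq_single i fun j hj => by simp [PMF.pure_apply, hj]]
  simp

lemma PMF.tsum_map_mul {ι κ : Type*} (q : PMF ι) (g : ι → κ) (f : κ → ℝ≥0∞) :
    ∑' k, q.map g k * f k = ∑' i, q i * f (g i) := by
  classical
  simp only [PMF.map_apply, ← ENNReal.tsum_mul_right]
  rw [ENNReal.tsum_comm]
  refine tsum_congr fun i => ?_
  rw [tsum_eq_single (g i) fun k hk => by simp [hk]]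
  simp

/-- If averaging two functions, one below the other, gives the same finite value, then they agree
wherever the weight is positive. -/
lemma PMF.eq_of_tsum_mul_le {ι : Type*} (q : PMF ι) {f g : ι → ℝ≥0∞} (hfg : ∀ i, f i ≤ g i)
    (hg : ∀ i, g i ≤ 1) (h : ∑' i, q i * g i ≤ ∑' i, q i * f i) {i : ι} (hi : q i ≠ 0) :
    f i = g i := by
  by_contra hne
  refine absurd h (not_le.2 ?_)
  refine ENNReal.tsum_lt_tsum (i := i) ?_ (fun j => mul_le_mul_right (hfg j) _) ?_
  · exact ne_top_of_le_ne_top ENNReal.one_ne_top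
      (q.tsum_mul_le fun j _ => (hfg j).trans (hg j))
  · exact ENNReal.mul_lt_mul_right hi (q.apply_ne_top i) (lt_of_le_of_ne (hfg i) hne)

lemma hitProb_le_one (s : M) : hitProb p A s ≤ 1 :=
  hitProb_le_of_superharmonic p A Set.univ (fun _ => 1) (fun _ _ _ => le_rfl)
    (fun _ _ _ _ _ => trivial) (fun _ _ _ => PMF.tsum_mul_le _ fun _ _ => le_rfl) trivial

/-- Two chains with the same transitions on a set `S` that they do not leave have the same hitting
probabilities from `S`. -/
lemma hitProb_congr (p' : M → PMF M) (S : Set M) (hp : ∀ s ∈ S, p s = p' s)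
    (hS : ∀ s ∈ S, ∀ t, p s t ≠ 0 → t ∈ S) {s : M} (hs : s ∈ S) :
    hitProb p A s = hitProb p' A s := by
  refine le_antisymm ?_ ?_
  · refine hitProb_le_of_superharmonic p A S _ (fun t _ h => (hitProb_of_mem p' A h).ge)
      (fun t ht _ => hS t ht) (fun t ht h => ?_) hs
    rw [hp t ht]; exact (hitProb_of_notMem p' A h).ge
  · refine hitProb_le_of_superharmonic p' A S _ (fun t _ h => (hitProb_of_mem p A h).ge)
      (fun t ht _ => hp t ht ▸ hS t ht) (fun t ht h => ?_) hs
    rw [← hp t ht]; exact (hitProb_of_notMem p A h).ge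

variable [MeasurableSpace M] [DiscreteMeasurableSpace M]

/-- The trajectories of the chain extend the given past. -/
lemma ae_traj_markovStep_eq (n : ℕ) (x : Finset.Iic n → M) :
    ∀ᵐ ω ∂(Kernel.traj (X := fun _ => M) (markovStep p) n x),
      ω n = x ⟨n, Finset.mem_Iic.2 le_rfl⟩ := by
  have h := Kernel.traj_map_frestrictLe_apply (X := fun _ => M) (κ := markovStep p) n n x
  rw [Kernel.partialTraj_self, Kernel.id_apply] at h
  have hm : MeasurableSet {y : Finset.Iic n → M | y ⟨n, Finset.mem_Iic.2 le_rfl⟩ =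
      x ⟨n, Finset.mem_Iic.2 le_rfl⟩} :=
    measurable_pi_apply (X := fun _ : Finset.Iic n => M) _
      (MeasurableSet.of_discrete (s := {x ⟨n, Finset.mem_Iic.2 le_rfl⟩}))
  have h2 : ∀ᵐ y ∂(Measure.dirac x), y ⟨n, Finset.mem_Iic.2 le_rfl⟩ =
      x ⟨n, Finset.mem_Iic.2 le_rfl⟩ := (ae_dirac_iff hm).2 rfl
  rw [← h] at h2
  exact ae_of_ae_map (by fun_prop) h2

lemma measurableSet_hits (m n : ℕ) :
    MeasurableSet {ω : ℕ → M | ∃ i, m ≤ i ∧ i ≤ m + n ∧ ω i ∈ A} := by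
  have : {ω : ℕ → M | ∃ i, m ≤ i ∧ i ≤ m + n ∧ ω i ∈ A} =
      ⋃ i, ⋃ (_ : m ≤ i ∧ i ≤ m + n), (fun ω : ℕ → M => ω i) ⁻¹' A := by
    ext ω; simp [and_assoc]
  rw [this]
  exact MeasurableSet.iUnion fun i => MeasurableSet.iUnion fun _ =>
    measurable_pi_apply (X := fun _ : ℕ => M) i MeasurableSet.of_discrete

/-- The Markov property, in the form that the number of steps already made is irrelevant for
hitting `A` within the next `n` steps. -/
lemma traj_markovStep_hits [Countable M] (n m : ℕ) (x : Finset.Iic m → M) :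
    Kernel.traj (X := fun _ => M) (markovStep p) m x
      {ω | ∃ i, m ≤ i ∧ i ≤ m + n ∧ ω i ∈ A} =
      hitWithin p A n (x ⟨m, Finset.mem_Iic.2 le_rfl⟩) := by
  by_cases hx : x ⟨m, Finset.mem_Iic.2 le_rfl⟩ ∈ A
  · rw [hitWithin_of_mem p A hx, prob_compl_eq_zero_iff (measurableSet_hits A m n) |>.symm]
    filter_upwards [ae_traj_markovStep_eq p m x] with ω hω
    exact ⟨m, le_rfl, by omega, hω ▸ hx⟩
  induction n generalizing m with
  | zero =>
    rw [hitWithin_zero_of_notMem p A hx, measure_eq_zero_iff_ae_notMem]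
    filter_upwards [ae_traj_markovStep_eq p m x] with ω hω
    rintro ⟨i, h1, h2, h3⟩
    obtain rfl : i = m := by omega
    exact hx (hω ▸ h3)
  | succ n ih =>
    have key : ∀ y : Finset.Iic (m + 1) → M,
        Kernel.traj (X := fun _ => M) (markovStep p) (m + 1) y
          {ω | ∃ i, m + 1 ≤ i ∧ i ≤ m + 1 + n ∧ ω i ∈ A} =
        hitWithin p A n (y ⟨m + 1, Finset.mem_Iic.2 le_rfl⟩) := by
      intro y
      by_cases hy : y ⟨m + 1, Finset.mem_Iic.2 le_rfl⟩ ∈ A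
      · rw [hitWithin_of_mem p A hy,
          prob_compl_eq_zero_iff (measurableSet_hits A (m + 1) n) |>.symm]
        filter_upwards [ae_traj_markovStep_eq p (m + 1) y] with ω hω
        exact ⟨m + 1, le_rfl, by omega, hω ▸ hy⟩
      · exact ih (m + 1) y hy
    have hstep : Kernel.traj (X := fun _ => M) (markovStep p) m x
        {ω | ∃ i, m ≤ i ∧ i ≤ m + (n + 1) ∧ ω i ∈ A} =
        Kernel.traj (X := fun _ => M) (markovStep p) m x
          {ω | ∃ i, m + 1 ≤ i ∧ i ≤ m + 1 + n ∧ ω i ∈ A} := by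
      refine measure_congr ?_
      filter_upwards [ae_traj_markovStep_eq p m x] with ω hω
      refine propext ⟨?_, ?_⟩
      · rintro ⟨i, h1, h2, h3⟩
        have : i ≠ m := by rintro rfl; exact hx (hω ▸ h3)
        exact ⟨i, by omega, by omega, h3⟩
      · rintro ⟨i, h1, h2, h3⟩
        exact ⟨i, by omega, by omega, h3⟩
    rw [hstep, ← Kernel.traj_comp_partialTraj (X := fun _ => M) (κ := markovStep p) m.le_succ,
      Kernel.comp_apply' _ _ _ (measurableSet_hits A (m + 1) n)]
    simp only [Nat.succ_eq_add_one, key]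
    have hmap := congrArg (fun k => k x)
      (Kernel.map_partialTraj_succ_self (X := fun _ => M) (κ := markovStep p) m)
    rw [Kernel.map_apply _ (by fun_prop)] at hmap
    rw [← lintegral_map (μ := Kernel.partialTraj (X := fun _ => M) (markovStep p) m (m + 1) x)
      (f := hitWithin p A n) (g := fun y => y ⟨m + 1, Finset.mem_Iic.2 le_rfl⟩)
      Measurable.of_discrete (by fun_prop), hmap, hitWithin_succ_of_notMem p A hx]
    change ∫⁻ a, hitWithin p A n a ∂(p (x ⟨m, Finset.mem_Iic.2 le_rfl⟩)).toMeasure = _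
    rw [lintegral_countable']
    refine tsum_congr fun t => ?_
    rw [PMF.toMeasure_apply_singleton _ _ (measurableSet_singleton t), mul_comm]

lemma markovMeasure_hits [Countable M] (s : M) :
    markovMeasure p s {ω | ∃ i, ω i ∈ A} = hitProb p A s := by
  have : {ω : ℕ → M | ∃ i, ω i ∈ A} = ⋃ n, {ω | ∃ i, 0 ≤ i ∧ i ≤ 0 + n ∧ ω i ∈ A} := by
    ext ω
    simp only [Set.mem_ofPred_eq, Set.mem_iUnion]
    exact ⟨fun ⟨i, h⟩ => ⟨i, i, by omega, by omega, h⟩, fun ⟨_, i, _, _, h⟩ => ⟨i, h⟩⟩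
  rw [this, Monotone.measure_iUnion]
  · exact iSup_congr fun n => traj_markovStep_hits p A n 0 _
  · rintro a b hab ω ⟨i, h1, h2, h3⟩
    exact ⟨i, h1, by omega, h3⟩

end Hitting

/-! ### Reachability as a function of the history -/

instance History.countable {V : Type*} [Countable V] : Countable (History V) :=
  Function.Injective.countable (f := fun h : History V => (h.past, h.last)) fun _ _ h =>
    History.ext (congrArg Prod.fst h) (congrArg Prod.snd h)

namespace StochasticGame

variable {V : Type*} {G : StochasticGame V}

/-- The successors of a vertex, as endpoints of its outgoing edges. -/
abbrev Succ (G : StochasticGame V) (v : V) : Type _ := {u // G.Edge v u}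

instance (v : V) : Nonempty (G.Succ v) :=
  let ⟨u, hu⟩ := G.total v; ⟨⟨u, hu⟩⟩

lemma edgeDist_box (σ : G.Strategy .box) (π : G.Strategy .diamond) {h : History V}
    (hk : G.owner h.last = .box) : edgeDist σ π h = σ h.past h.last hk := by
  unfold edgeDist; split <;> first | rfl | (rename_i h'; exact nomatch hk.symm.trans h')

lemma edgeDist_diamond (σ : G.Strategy .box) (π : G.Strategy .diamond) {h : History V}
    (hk : G.owner h.last = .diamond) : edgeDist σ π h = π h.past h.last hk := by
  unfold edgeDist; split <;> first | rfl | (rename_i h'; exact nomatch hk.symm.trans h')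

lemma edgeDist_circle (σ : G.Strategy .box) (π : G.Strategy .diamond) {h : History V}
    (hk : G.owner h.last = .circle) : edgeDist σ π h = G.prob h.last hk := by
  unfold edgeDist; split <;> first | rfl | (rename_i h'; exact nomatch hk.symm.trans h')

/-- The probability that the play, continued after the history `h`, visits `T` at the end of `h` or
later. -/
noncomputable def reachFrom (T : Set V) (σ : G.Strategy .box) (π : G.Strategy .diamond)
    (h : History V) : ℝ≥0∞ :=
  hitProb (play σ π) {h | h.last ∈ T} h

variable (T : Set V) (σ : G.Strategy .box) (π : G.Strategy .diamond)

lemma reachProb_eq_toReal_reachFrom [Countable V] (v : V) :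
    reachProb σ π v T = (reachFrom T σ π ⟨[], v⟩).toReal :=
  congrArg ENNReal.toReal (markovMeasure_hits (play σ π) {h | h.last ∈ T} ⟨[], v⟩)

lemma reachFrom_le_one (h : History V) : reachFrom T σ π h ≤ 1 := hitProb_le_one _ _ _

lemma reachFrom_of_mem {h : History V} (hT : h.last ∈ T) : reachFrom T σ π h = 1 :=
  hitProb_of_mem _ _ hT

lemma tsum_play_mul (h : History V) (f : History V → ℝ≥0∞) :
    ∑' t, play σ π h t * f t = ∑' u, edgeDist σ π h u * f (h.snoc u.1) :=
  PMF.tsum_map_mul _ _ _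

lemma exists_of_play_ne_zero {h t : History V} (ht : play σ π h t ≠ 0) :
    ∃ u, edgeDist σ π h u ≠ 0 ∧ h.snoc u.1 = t :=
  (PMF.mem_support_map_iff _ _ _).1 ((PMF.mem_support_iff _ _).2 ht)

lemma reachFrom_of_notMem {h : History V} (hT : h.last ∉ T) :
    reachFrom T σ π h = ∑' u, edgeDist σ π h u * reachFrom T σ π (h.snoc u.1) := by
  unfold reachFrom
  rw [hitProb_of_notMem _ {h : History V | h.last ∈ T} hT, tsum_play_mul]

lemma reachFrom_le_of_superharmonic (S : Set (History V)) (f : History V → ℝ≥0∞)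
    (hA : ∀ h ∈ S, h.last ∈ T → 1 ≤ f h)
    (hS : ∀ h ∈ S, h.last ∉ T → ∀ u, edgeDist σ π h u ≠ 0 → h.snoc u.1 ∈ S)
    (hf : ∀ h ∈ S, h.last ∉ T → ∑' u, edgeDist σ π h u * f (h.snoc u.1) ≤ f h)
    {h : History V} (hh : h ∈ S) : reachFrom T σ π h ≤ f h := by
  refine hitProb_le_of_superharmonic _ _ S f hA (fun s hs hT t ht => ?_) (fun s hs hT => ?_) hh
  · obtain ⟨u, hu, rfl⟩ := exists_of_play_ne_zero σ π ht
    exact hS s hs hT u hu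
  · rw [tsum_play_mul]; exact hf s hs hT

lemma reachFrom_congr {σ σ' : G.Strategy .box} {π π' : G.Strategy .diamond} (S : Set (History V))
    (he : ∀ h ∈ S, edgeDist σ π h = edgeDist σ' π' h)
    (hS : ∀ h ∈ S, ∀ u : G.Succ h.last, h.snoc u.1 ∈ S)
    {h : History V} (hh : h ∈ S) : reachFrom T σ π h = reachFrom T σ' π' h := by
  refine hitProb_congr _ _ _ S (fun s hs => by simp only [play, he s hs]) (fun s hs t ht => ?_) hh
  obtain ⟨u, -, rfl⟩ := exists_of_play_ne_zero σ π ht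
  exact hS s hs u

lemma reachFrom_box {h : History V} (hT : h.last ∉ T) (hk : G.owner h.last = .box) :
    reachFrom T σ π h = ∑' u, σ h.past h.last hk u * reachFrom T σ π (h.snoc u.1) := by
  rw [reachFrom_of_notMem T σ π hT, edgeDist_box σ π hk]

lemma reachFrom_diamond {h : History V} (hT : h.last ∉ T) (hk : G.owner h.last = .diamond) :
    reachFrom T σ π h = ∑' u, π h.past h.last hk u * reachFrom T σ π (h.snoc u.1) := by
  rw [reachFrom_of_notMem T σ π hT, edgeDist_diamond σ π hk]

lemma reachFrom_circle {h : History V} (hT : h.last ∉ T) (hk : G.owner h.last = .circle) :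
    reachFrom T σ π h = ∑' u, G.prob h.last hk u * reachFrom T σ π (h.snoc u.1) := by
  rw [reachFrom_of_notMem T σ π hT, edgeDist_circle σ π hk]

/-! ### Value iteration -/

/-- A restriction of the moves of the two players, depending on the history. -/
abbrev Moves (G : StochasticGame V) : Type _ := ∀ h : History V, G.Succ h.last → Prop

/-- The Bellman operator of the game in which player `□` only makes moves in `A` and player `◇`
only moves in `B`. A player without a permitted move gets the worst outcome, which for `◇` is
the value `∞`. -/
noncomputable def bellman (A B : G.Moves) (f : History V → ℝ≥0∞) (h : History V) : ℝ≥0∞ :=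
  match hk : G.owner h.last with
  | .box => ⨆ u : G.Succ h.last, ⨆ _ : A h u, f (h.snoc u.1)
  | .diamond => ⨅ u : G.Succ h.last, ⨅ _ : B h u, f (h.snoc u.1)
  | .circle => ∑' u, G.prob h.last hk u * f (h.snoc u.1)

variable (A B : G.Moves)

lemma bellman_box (f : History V → ℝ≥0∞) {h : History V} (hk : G.owner h.last = .box) :
    bellman A B f h = ⨆ u : G.Succ h.last, ⨆ _ : A h u, f (h.snoc u.1) := by
  unfold bellman; split <;> simp_all

lemma bellman_diamond (f : History V → ℝ≥0∞) {h : History V} (hk : G.owner h.last = .diamond) :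
    bellman A B f h = ⨅ u : G.Succ h.last, ⨅ _ : B h u, f (h.snoc u.1) := by
  unfold bellman; split <;> simp_all

lemma bellman_circle (f : History V → ℝ≥0∞) {h : History V} (hk : G.owner h.last = .circle) :
    bellman A B f h = ∑' u, G.prob h.last hk u * f (h.snoc u.1) := by
  unfold bellman; split <;> simp_all

lemma bellman_mono {f g : History V → ℝ≥0∞} (hfg : ∀ h, f h ≤ g h) (h : History V) :
    bellman A B f h ≤ bellman A B g h := by
  cases hk : G.owner h.last
  · rw [bellman_box _ _ _ hk, bellman_box _ _ _ hk]
    exact iSup₂_mono fun u _ => hfg _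
  · rw [bellman_diamond _ _ _ hk, bellman_diamond _ _ _ hk]
    exact iInf₂_mono fun u _ => hfg _
  · rw [bellman_circle _ _ _ hk, bellman_circle _ _ _ hk]
    exact ENNReal.tsum_le_tsum fun u => mul_le_mul_right (hfg _) _

/-- The value of the game with moves restricted to `A` and `B` in which `T` has to be reached
within `n` steps. -/
noncomputable def valueWithin (n : ℕ) : History V → ℝ≥0∞ :=
  match n with
  | 0 => fun h => T.indicator 1 h.last
  | n + 1 => fun h => open Classical in
      if h.last ∈ T then 1 else bellman A B (valueWithin n) h

/-- The value of the reachability game with moves restricted to `A` and `B`. -/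
noncomputable def restrictedValue (h : History V) : ℝ≥0∞ := ⨆ n, valueWithin T A B n h

lemma valueWithin_of_mem {h : History V} (hT : h.last ∈ T) (n : ℕ) :
    valueWithin T A B n h = 1 := by
  cases n <;> simp [valueWithin, hT]

lemma valueWithin_zero_of_notMem {h : History V} (hT : h.last ∉ T) :
    valueWithin T A B 0 h = 0 := by
  simp [valueWithin, hT]

lemma valueWithin_succ_of_notMem {h : History V} (hT : h.last ∉ T) (n : ℕ) :
    valueWithin T A B (n + 1) h = bellman A B (valueWithin T A B n) h := by
  simp [valueWithin, hT]

lemma valueWithin_le_succ (n : ℕ) (h : History V) :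
    valueWithin T A B n h ≤ valueWithin T A B (n + 1) h := by
  induction n generalizing h with
  | zero =>
    by_cases hT : h.last ∈ T
    · simp [valueWithin_of_mem, hT]
    · simp [valueWithin_zero_of_notMem, hT]
  | succ n ih =>
    by_cases hT : h.last ∈ T
    · simp [valueWithin_of_mem, hT]
    rw [valueWithin_succ_of_notMem _ _ _ hT, valueWithin_succ_of_notMem _ _ _ hT]
    exact bellman_mono A B ih h

lemma valueWithin_mono (h : History V) : Monotone fun n => valueWithin T A B n h :=
  monotone_nat_of_le_succ fun n => valueWithin_le_succ T A B n h

lemma restrictedValue_of_mem {h : History V} (hT : h.last ∈ T) : restrictedValue T A B h = 1 := by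
  simp [restrictedValue, valueWithin_of_mem, hT]

/-- The value satisfies the Bellman equation. This needs finite branching, which allows to
exchange the choice of `◇` with the limit of the horizon. -/
lemma restrictedValue_of_notMem (hG : G.FinitelyBranching) {h : History V} (hT : h.last ∉ T) :
    restrictedValue T A B h = bellman A B (restrictedValue T A B) h := by
  have h1 : restrictedValue T A B h = ⨆ n, bellman A B (valueWithin T A B n) h := by
    rw [restrictedValue, ← (valueWithin_mono T A B h).iSup_nat_add 1]
    exact iSup_congr fun n => valueWithin_succ_of_notMem T A B hT n
  rw [h1]
  cases hk : G.owner h.last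
  · simp only [bellman_box _ _ _ hk, restrictedValue]
    rw [iSup_comm]
    exact iSup_congr fun u => iSup_comm
  · simp only [bellman_diamond _ _ _ hk, restrictedValue]
    have : Finite (G.Succ h.last) := (hG h.last).to_subtype
    rw [iSup_iInf_of_monotone]
    · refine iInf_congr fun u => ?_
      by_cases hu : B h u <;> simp [hu]
    · exact fun u m n hmn => iInf_mono fun _ => valueWithin_mono T A B _ hmn
  · simp only [bellman_circle _ _ _ hk, restrictedValue]
    exact (PMF.tsum_mul_iSup_of_monotone _ fun u => valueWithin_mono T A B _).symm

/-- The value of the reachability game after the history `h`. -/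
noncomputable def value (G : StochasticGame V) (T : Set V) (h : History V) : ℝ≥0∞ :=
  restrictedValue (G := G) T (fun _ _ => True) (fun _ _ => True) h

lemma value_of_mem {h : History V} (hT : h.last ∈ T) : G.value T h = 1 :=
  restrictedValue_of_mem _ _ _ hT

lemma value_le_one (h : History V) : G.value T h ≤ 1 := by
  refine iSup_le fun n => ?_
  induction n generalizing h with
  | zero =>
    by_cases hT : h.last ∈ T
    · simp [valueWithin_of_mem, hT]
    · simp [valueWithin_zero_of_notMem, hT]
  | succ n ih =>
    by_cases hT : h.last ∈ T
    · simp [valueWithin_of_mem, hT]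
    rw [valueWithin_succ_of_notMem _ _ _ hT]
    cases hk : G.owner h.last
    · rw [bellman_box _ _ _ hk]
      exact iSup₂_le fun u _ => ih _
    · rw [bellman_diamond _ _ _ hk]
      obtain ⟨u⟩ : Nonempty (G.Succ h.last) := inferInstance
      exact iInf₂_le_of_le u trivial (ih _)
    · rw [bellman_circle _ _ _ hk]
      exact PMF.tsum_mul_le _ fun u _ => ih _

variable {T}

lemma value_snoc_le_of_box (hG : G.FinitelyBranching) {h : History V} (hT : h.last ∉ T)
    (hk : G.owner h.last = .box) (u : G.Succ h.last) : G.value T (h.snoc u.1) ≤ G.value T h := by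
  rw [value, value, restrictedValue_of_notMem T _ _ hG hT, bellman_box _ _ _ hk]
  exact le_iSup₂_of_le u trivial le_rfl

lemma le_value_snoc_of_diamond (hG : G.FinitelyBranching) {h : History V} (hT : h.last ∉ T)
    (hk : G.owner h.last = .diamond) (u : G.Succ h.last) :
    G.value T h ≤ G.value T (h.snoc u.1) := by
  rw [value, value, restrictedValue_of_notMem T _ _ hG hT, bellman_diamond _ _ _ hk]
  exact iInf₂_le_of_le u trivial le_rfl

lemma value_of_circle (hG : G.FinitelyBranching) {h : History V} (hT : h.last ∉ T)
    (hk : G.owner h.last = .circle) :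
    G.value T h = ∑' u, G.prob h.last hk u * G.value T (h.snoc u.1) := by
  conv_lhs => rw [value, restrictedValue_of_notMem T _ _ hG hT, bellman_circle _ _ _ hk]
  rfl

lemma exists_value_snoc_eq_of_diamond (hG : G.FinitelyBranching) {h : History V} (hT : h.last ∉ T)
    (hk : G.owner h.last = .diamond) :
    ∃ u : G.Succ h.last, G.value T (h.snoc u.1) = G.value T h := by
  have : Finite (G.Succ h.last) := (hG h.last).to_subtype
  obtain ⟨u, hu⟩ := exists_eq_ciInf_of_finite (f := fun u : G.Succ h.last => G.value T (h.snoc u.1))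
  refine ⟨u, hu.trans ?_⟩
  conv_rhs => rw [value, restrictedValue_of_notMem T _ _ hG hT, bellman_diamond _ _ _ hk]
  simp [value]

/-! ### Memoryless and finite-horizon strategies -/

/-- `π` only makes moves that preserve the value. -/
def ValuePreserving (T : Set V) (π : G.Strategy .diamond) : Prop :=
  ∀ (h : History V) (hk : G.owner h.last = .diamond), h.last ∉ T → ∀ u,
    π h.past h.last hk u ≠ 0 → G.value T (h.snoc u.1) = G.value T h

/-- The deterministic strategy that moves to `c h` after the history `h`. -/
noncomputable def Strategy.ofChoice {k : VertexKind} (c : ∀ h : History V, G.Succ h.last) :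
    G.Strategy k :=
  fun w v _ => PMF.pure (c ⟨w, v⟩)

/-- The average of the value over the next moves is at most the current value if `◇` preserves the
value. -/
lemma tsum_edgeDist_mul_value_le (hG : G.FinitelyBranching) {h : History V} (hT : h.last ∉ T)
    (hπ : ∀ (hk : G.owner h.last = .diamond) (u), π h.past h.last hk u ≠ 0 →
      G.value T (h.snoc u.1) = G.value T h) :
    ∑' u, edgeDist σ π h u * G.value T (h.snoc u.1) ≤ G.value T h := by
  cases hk : G.owner h.last
  · exact PMF.tsum_mul_le _ fun u _ => value_snoc_le_of_box hG hT hk u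
  · rw [edgeDist_diamond σ π hk]
    exact PMF.tsum_mul_le _ fun u hu => (hπ hk u hu).le
  · rw [edgeDist_circle σ π hk, value_of_circle hG hT hk]

variable {π} in
lemma reachFrom_le_value (hG : G.FinitelyBranching) (hπ : ValuePreserving T π) (h : History V) :
    reachFrom T σ π h ≤ G.value T h :=
  reachFrom_le_of_superharmonic T σ π Set.univ _ (fun _ _ hT => (value_of_mem T hT).ge)
    (fun _ _ _ _ _ => trivial)
    (fun h _ hT => tsum_edgeDist_mul_value_le σ π hG hT fun hk => hπ h hk hT) trivial

lemma valuePreserving_ofChoice (c : ∀ h : History V, G.Succ h.last)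
    (hc : ∀ h : History V, h.last ∉ T → G.owner h.last = .diamond →
      G.value T (h.snoc (c h).1) = G.value T h) :
    ValuePreserving T (Strategy.ofChoice c) := by
  intro h hk hT u hu
  have : u = c h := by
    by_contra hne
    exact hu (by simp [Strategy.ofChoice, PMF.pure_apply, hne])
  rw [this]; exact hc h hT hk

lemma exists_valuePreserving (hG : G.FinitelyBranching) (T : Set V) :
    ∃ π : G.Strategy .diamond, ValuePreserving T π := by
  have : ∀ h : History V, ∃ u : G.Succ h.last, h.last ∉ T → G.owner h.last = .diamond →
      G.value T (h.snoc u.1) = G.value T h := by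
    intro h
    by_cases hh : h.last ∉ T ∧ G.owner h.last = .diamond
    · obtain ⟨u, hu⟩ := exists_value_snoc_eq_of_diamond hG hh.1 hh.2
      exact ⟨u, fun _ _ => hu⟩
    · obtain ⟨u⟩ : Nonempty (G.Succ h.last) := inferInstance
      exact ⟨u, fun h1 h2 => absurd ⟨h1, h2⟩ hh⟩
  choose c hc using this
  exact ⟨_, valuePreserving_ofChoice c hc⟩

/-- Player `□` can guarantee the value with horizon `n`: with the deadline fixed, maximize the
value for the remaining number of steps. -/
lemma exists_valueWithin_le (hG : G.FinitelyBranching) (T : Set V) (n : ℕ) (h₀ : History V) :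
    ∃ σ : G.Strategy .box, ∀ π : G.Strategy .diamond,
      valueWithin (G := G) T (fun _ _ => True) (fun _ _ => True) n h₀ ≤ reachFrom T σ π h₀ := by
  set w := valueWithin (G := G) T (fun _ _ => True) (fun _ _ => True) with hw
  have hmax : ∀ (m : ℕ) (h : History V), ∃ u : G.Succ h.last, ∀ u' : G.Succ h.last,
      w m (h.snoc u'.1) ≤ w m (h.snoc u.1) := fun m h => by
    have : Finite (G.Succ h.last) := (hG h.last).to_subtype
    exact Finite.exists_max _
  choose c hc using hmax
  refine ⟨Strategy.ofChoice fun h => c (h₀.past.length + n - h.past.length - 1) h, fun π => ?_⟩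
  set σ : G.Strategy .box :=
    Strategy.ofChoice fun h => c (h₀.past.length + n - h.past.length - 1) h with hσ
  suffices H : ∀ m (h : History V), h.past.length + m = h₀.past.length + n →
      w m h ≤ reachFrom T σ π h from H n h₀ rfl
  intro m
  induction m with
  | zero =>
    intro h _
    by_cases hT : h.last ∈ T
    · rw [reachFrom_of_mem T σ π hT, hw, valueWithin_of_mem _ _ _ hT]
    · simp [hw, valueWithin_zero_of_notMem _ _ _ hT]
  | succ m ih =>
    intro h hm
    by_cases hT : h.last ∈ T
    · rw [reachFrom_of_mem T σ π hT, hw, valueWithin_of_mem _ _ _ hT]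
    have ih' : ∀ u : G.Succ h.last, w m (h.snoc u.1) ≤ reachFrom T σ π (h.snoc u.1) := fun u =>
      ih _ (by simp [History.snoc]; omega)
    rw [hw, valueWithin_succ_of_notMem _ _ _ hT, ← hw]
    cases hk : G.owner h.last
    · rw [bellman_box _ _ _ hk, reachFrom_box T σ π hT hk]
      have hlen : h₀.past.length + n - h.past.length - 1 = m := by omega
      simp only [hσ, Strategy.ofChoice, PMF.tsum_pure_mul]
      rw [hlen]
      exact iSup₂_le fun u _ => (hc m h u).trans (ih' _)
    · rw [bellman_diamond _ _ _ hk, reachFrom_diamond T σ π hT hk]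
      exact PMF.le_tsum_mul _ fun u _ => iInf₂_le_of_le u trivial (ih' u)
    · rw [bellman_circle _ _ _ hk, reachFrom_circle T σ π hT hk]
      exact ENNReal.tsum_le_tsum fun u => mul_le_mul_right (ih' u) _

/-- `□` comes arbitrarily close to the value. -/
lemma exists_lt_reachFrom_of_lt_value (hG : G.FinitelyBranching) {h : History V} {x : ℝ≥0∞}
    (hx : x < G.value T h) :
    ∃ σ : G.Strategy .box, ∀ π : G.Strategy .diamond, x < reachFrom T σ π h := by
  obtain ⟨n, hn⟩ := lt_iSup_iff.1 hx
  obtain ⟨σ, hσ⟩ := exists_valueWithin_le hG T n h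
  exact ⟨σ, fun π => hn.trans_le (hσ π)⟩

end StochasticGame

/-! ### Strategies with memory -/

namespace History

variable {V M : Type*}

lemma snoc_induction {P : History V → Prop} (root : ∀ v, P ⟨[], v⟩)
    (snoc : ∀ h u, P h → P (h.snoc u)) (h : History V) : P h := by
  obtain ⟨w, v⟩ := h
  induction w using List.reverseRecOn generalizing v with
  | nil => exact root v
  | append_singleton w u ih => exact snoc ⟨w, u⟩ v (ih u)

/-- The content of a memory that starts as `m₀ v` in the vertex `v` and is updated to `upd m h u`
when the play moves to the vertex `u` after the history `h`. -/
def memory (m₀ : V → M) (upd : M → History V → V → M) (h : History V) : M :=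
  if hp : h.past = [] then m₀ h.last
  else upd (memory m₀ upd ⟨h.past.dropLast, h.past.getLast hp⟩)
    ⟨h.past.dropLast, h.past.getLast hp⟩ h.last
termination_by h.past.length
decreasing_by
  have := List.length_pos_iff.2 hp
  simp only [List.length_dropLast]; omega

lemma memory_root (m₀ : V → M) (upd : M → History V → V → M) (v : V) :
    memory m₀ upd ⟨[], v⟩ = m₀ v := by
  rw [memory]; simp

lemma memory_snoc (m₀ : V → M) (upd : M → History V → V → M) (h : History V) (u : V) :
    memory m₀ upd (h.snoc u) = upd (memory m₀ upd h) h u := by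
  rw [memory]; simp [snoc]

end History

namespace StochasticGame

variable {V : Type*} {G : StochasticGame V}

/-- The strategy that after the history `h` plays as `s h` does. -/
def Strategy.switch {k : VertexKind} (s : History V → G.Strategy k) : G.Strategy k :=
  fun w v hv => s ⟨w, v⟩ w v hv

/-- Where the switching is over, the switching strategy is worth what the current one is. -/
lemma reachFrom_switch_box (T : Set V) {s : History V → G.Strategy .box} {τ : G.Strategy .box}
    {π : G.Strategy .diamond} (S : Set (History V)) (hs : ∀ h ∈ S, s h = τ)
    (hS : ∀ h ∈ S, ∀ u : G.Succ h.last, h.snoc u.1 ∈ S) {h : History V} (hh : h ∈ S) :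
    reachFrom T (Strategy.switch s) π h = reachFrom T τ π h := by
  refine reachFrom_congr T S (fun h hh => ?_) hS hh
  cases hk : G.owner h.last
  · simp only [edgeDist_box _ _ hk, Strategy.switch, hs h hh]
  · simp only [edgeDist_diamond _ _ hk]
  · simp only [edgeDist_circle _ _ hk]

lemma reachFrom_switch_diamond (T : Set V) {s : History V → G.Strategy .diamond}
    {τ : G.Strategy .diamond} {σ : G.Strategy .box} (S : Set (History V))
    (hs : ∀ h ∈ S, s h = τ) (hS : ∀ h ∈ S, ∀ u : G.Succ h.last, h.snoc u.1 ∈ S)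
    {h : History V} (hh : h ∈ S) :
    reachFrom T σ (Strategy.switch s) h = reachFrom T σ τ h := by
  refine reachFrom_congr T S (fun h hh => ?_) hS hh
  cases hk : G.owner h.last
  · simp only [edgeDist_box _ _ hk]
  · simp only [edgeDist_diamond _ _ hk, Strategy.switch, hs h hh]
  · simp only [edgeDist_circle _ _ hk]

/-! ### Histories from which the value cannot be undercut -/

/-- The histories after which player `◇` has a strategy that keeps the reachability probability
strictly below the value, whatever player `□` does. -/
def undercutRegion (G : StochasticGame V) (T : Set V) : Set (History V) :=
  {h | ∃ π : G.Strategy .diamond, ∀ σ : G.Strategy .box, reachFrom T σ π h < G.value T h}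

variable {T : Set V}

/-- Let `◇` play a value-preserving strategy `π₀`, but switch to a strategy undercutting the value
as soon as that is possible. If this does not undercut the value after `h₀`, some strategy of `□`
attains the value against it, and then the switch never happens and no player ever gives away any
value. The set `S` collects histories of this play. -/
theorem exists_play_attaining_value (hG : G.FinitelyBranching) {π₀ : G.Strategy .diamond}
    (hπ₀ : ValuePreserving T π₀) {h₀ : History V} (hh₀ : h₀ ∉ G.undercutRegion T) :
    ∃ (σ : G.Strategy .box) (π : G.Strategy .diamond) (S : Set (History V)), h₀ ∈ S ∧
      ∀ h ∈ S, h ∉ G.undercutRegion T ∧ reachFrom T σ π h = G.value T h ∧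
        (∀ hk, π h.past h.last hk = π₀ h.past h.last hk) ∧
        (h.last ∉ T → ∀ u, edgeDist σ π h u ≠ 0 →
          h.snoc u.1 ∈ S ∧ (G.owner h.last = .box → G.value T (h.snoc u.1) = G.value T h)) := by
  classical
  have : ∀ h : History V, ∃ τ : G.Strategy .diamond, h ∈ G.undercutRegion T →
      ∀ σ : G.Strategy .box, reachFrom T σ τ h < G.value T h := fun h => by
    by_cases hh : h ∈ G.undercutRegion T
    · obtain ⟨τ, hτ⟩ := hh
      exact ⟨τ, fun _ => hτ⟩
    · exact ⟨π₀, fun h' => absurd h' hh⟩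
  choose τ hτ using this
  -- Entries into the region before the end of `h₀` are ignored.
  set X : Set (History V) := {h | h ∈ G.undercutRegion T ∧ h₀.past.length < h.past.length} with hX
  set mode : History V → Option (G.Strategy .diamond) := History.memory (fun _ => none)
    (fun m h u => m <|> if h.snoc u ∈ X then some (τ (h.snoc u)) else none) with hmode
  have mode_snoc (h : History V) (u : V) : mode (h.snoc u) =
      (mode h <|> if h.snoc u ∈ X then some (τ (h.snoc u)) else none) :=
    History.memory_snoc _ _ h u
  have mode_some {h : History V} {ρ : G.Strategy .diamond} (hm : mode h = some ρ) (u : V) :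
      mode (h.snoc u) = some ρ := by simp [mode_snoc, hm]
  have mode_none (h : History V) (hl : h.past.length ≤ h₀.past.length) : mode h = none := by
    induction h using History.snoc_induction with
    | root v => exact History.memory_root _ _ v
    | snoc h u ih =>
      have hnot : h.snoc u ∉ X := fun hx => (not_lt.2 hl) hx.2
      have hl' : h.past.length ≤ h₀.past.length := by
        simp only [History.snoc, List.length_append, List.length_singleton] at hl; omega
      simp [mode_snoc, hnot, ih hl']
  set π : G.Strategy .diamond := Strategy.switch fun h => (mode h).getD π₀ with hπ
  have reach_some (σ : G.Strategy .box) {h : History V} {ρ : G.Strategy .diamond}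
      (hm : mode h = some ρ) : reachFrom T σ π h = reachFrom T σ ρ h :=
    reachFrom_switch_diamond T {h | mode h = some ρ} (fun h (hh : mode h = some ρ) => by simp [hh])
      (fun h hh u => mode_some hh u.1) hm
  have enter (σ : G.Strategy .box) {h : History V} {u : V} (hm : mode h = none)
      (hu : h.snoc u ∈ X) : reachFrom T σ π (h.snoc u) < G.value T (h.snoc u) := by
    have : mode (h.snoc u) = some (τ (h.snoc u)) := by simp [mode_snoc, hm, hu]
    rw [reach_some σ this]
    exact hτ _ hu.1 σ
  have π_eq {h : History V} (hm : mode h = none) (hk) :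
      π h.past h.last hk = π₀ h.past h.last hk := by simp [hπ, Strategy.switch, hm]
  have avg_le (σ : G.Strategy .box) {h : History V} (hm : mode h = none) (hT : h.last ∉ T) :
      ∑' u, edgeDist σ π h u * G.value T (h.snoc u.1) ≤ G.value T h :=
    tsum_edgeDist_mul_value_le σ π hG hT fun hk u hu => hπ₀ h hk hT u (by rwa [← π_eq hm])
  have upper (σ : G.Strategy .box) {h : History V} (hm : mode h = none) :
      reachFrom T σ π h ≤ G.value T h := by
    set f : History V → ℝ≥0∞ :=
      fun h => if mode h = none then G.value T h else reachFrom T σ π h with hf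
    have hle : reachFrom T σ π h ≤ f h := by
      refine reachFrom_le_of_superharmonic T σ π Set.univ f (fun h _ hT => ?_)
        (fun _ _ _ _ _ => trivial) (fun h _ hT => ?_) trivial
      · simp only [hf]; split_ifs
        · exact (value_of_mem T hT).ge
        · exact (reachFrom_of_mem T σ π hT).ge
      · cases hm : mode h with
        | none =>
          have : f h = G.value T h := by simp [hf, hm]
          rw [this]
          refine le_trans (ENNReal.tsum_le_tsum fun u => mul_le_mul_right ?_ _) (avg_le σ hm hT)
          by_cases hu : h.snoc u.1 ∈ X
          · have hne : mode (h.snoc u.1) ≠ none := by simp [mode_snoc, hm, hu]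
            simp only [hf, hne, if_false]
            exact (enter σ hm hu).le
          · simp [hf, mode_snoc, hm, hu]
        | some ρ =>
          have : f h = reachFrom T σ π h := by simp [hf, hm]
          rw [this, reachFrom_of_notMem T σ π hT]
          refine le_of_eq (tsum_congr fun u => ?_)
          simp [hf, mode_some hm]
    simpa [hf, hm] using hle
  obtain ⟨σ, hσ⟩ : ∃ σ : G.Strategy .box, G.value T h₀ ≤ reachFrom T σ π h₀ := by
    by_contra! hcon
    exact hh₀ ⟨π, hcon⟩
  have hm₀ : mode h₀ = none := mode_none h₀ le_rfl
  refine ⟨σ, π, {h | mode h = none ∧ h ∉ G.undercutRegion T ∧ h₀.past.length ≤ h.past.length ∧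
    reachFrom T σ π h = G.value T h}, ⟨hm₀, hh₀, le_rfl, (upper σ hm₀).antisymm hσ⟩, ?_⟩
  rintro h ⟨hm, hD, hl, hR⟩
  refine ⟨hD, hR, π_eq hm, fun hT u hu => ?_⟩
  have child_le (u : G.Succ h.last) : reachFrom T σ π (h.snoc u.1) ≤ G.value T (h.snoc u.1) := by
    by_cases hu : h.snoc u.1 ∈ X
    · exact (enter σ hm hu).le
    · exact upper σ (by simp [mode_snoc, hm, hu])
  have hRu : reachFrom T σ π (h.snoc u.1) = G.value T (h.snoc u.1) := by
    refine (edgeDist σ π h).eq_of_tsum_mul_le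
      (f := fun u => reachFrom T σ π (h.snoc u.1)) (g := fun u => G.value T (h.snoc u.1))
      child_le (fun _ => value_le_one T _) ?_ hu
    rw [← reachFrom_of_notMem T σ π hT, hR]
    exact avg_le σ hm hT
  have huX : h.snoc u.1 ∉ X := fun hx => (enter σ hm hx).ne hRu
  have hlu : h₀.past.length < (h.snoc u.1).past.length := by
    simp only [History.snoc, List.length_append, List.length_singleton]; omega
  refine ⟨⟨by simp [mode_snoc, hm, huX], fun hd => huX ⟨hd, hlu⟩, hlu.le, hRu⟩, fun hk => ?_⟩
  refine (edgeDist σ π h).eq_of_tsum_mul_le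
    (f := fun u => G.value T (h.snoc u.1)) (g := fun _ => G.value T h)
    (value_snoc_le_of_box hG hT hk) (fun _ => value_le_one T _) ?_ hu
  calc ∑' u, edgeDist σ π h u * G.value T h = reachFrom T σ π h := by
        rw [ENNReal.tsum_mul_right, PMF.tsum_coe, one_mul, hR]
    _ ≤ _ := by
        rw [reachFrom_of_notMem T σ π hT]
        exact ENNReal.tsum_le_tsum fun u => mul_le_mul_right (child_le u) _

/-- From a history where the value cannot be undercut, `□` can make a value-preserving move
to another such history. -/
lemma exists_snoc_notMem_undercutRegion_of_box (hG : G.FinitelyBranching) {h : History V}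
    (hT : h.last ∉ T) (hh : h ∉ G.undercutRegion T) (hk : G.owner h.last = .box) :
    ∃ u : G.Succ h.last, h.snoc u.1 ∉ G.undercutRegion T ∧
      G.value T (h.snoc u.1) = G.value T h := by
  obtain ⟨π₀, hπ₀⟩ := exists_valuePreserving hG T
  obtain ⟨σ, π, S, hS, H⟩ := exists_play_attaining_value hG hπ₀ hh
  obtain ⟨u, hu⟩ := (edgeDist σ π h).support_nonempty
  obtain ⟨huS, huv⟩ := (H h hS).2.2.2 hT u ((PMF.mem_support_iff _ _).1 hu)
  exact ⟨u, (H _ huS).1, huv hk⟩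

lemma snoc_notMem_undercutRegion_of_circle (hG : G.FinitelyBranching) {h : History V}
    (hT : h.last ∉ T) (hh : h ∉ G.undercutRegion T) (hk : G.owner h.last = .circle)
    (u : G.Succ h.last) : h.snoc u.1 ∉ G.undercutRegion T := by
  obtain ⟨π₀, hπ₀⟩ := exists_valuePreserving hG T
  obtain ⟨σ, π, S, hS, H⟩ := exists_play_attaining_value hG hπ₀ hh
  refine (H _ ((H h hS).2.2.2 hT u ?_).1).1
  rw [edgeDist_circle σ π hk]
  exact (G.prob_pos _ hk u).ne'

lemma snoc_notMem_undercutRegion_of_diamond (hG : G.FinitelyBranching) {h : History V}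
    (hT : h.last ∉ T) (hh : h ∉ G.undercutRegion T) (hk : G.owner h.last = .diamond)
    (u : G.Succ h.last) (hu : G.value T (h.snoc u.1) = G.value T h) :
    h.snoc u.1 ∉ G.undercutRegion T := by
  classical
  obtain ⟨π₁, hπ₁⟩ := exists_valuePreserving hG T
  -- Modify a value-preserving strategy so that it moves to `u` after `h`.
  have hc : ∀ h' : History V, ∃ u' : G.Succ h'.last, (h' = h → u'.1 = u.1) ∧
      (h'.last ∉ T → G.owner h'.last = .diamond →
        G.value T (h'.snoc u'.1) = G.value T h') := by
    intro h'
    by_cases he : h' = h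
    · subst he
      exact ⟨u, fun _ => rfl, fun _ _ => hu⟩
    by_cases hh' : h'.last ∉ T ∧ G.owner h'.last = .diamond
    · obtain ⟨u', hu'⟩ := exists_value_snoc_eq_of_diamond hG hh'.1 hh'.2
      exact ⟨u', fun e => absurd e he, fun _ _ => hu'⟩
    · obtain ⟨u'⟩ : Nonempty (G.Succ h'.last) := inferInstance
      exact ⟨u', fun e => absurd e he, fun h1 h2 => absurd ⟨h1, h2⟩ hh'⟩
  choose c hcu hcv using hc
  obtain ⟨σ, π, S, hS, H⟩ :=
    exists_play_attaining_value hG (valuePreserving_ofChoice (G := G) (T := T) c hcv) hh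
  refine (H _ ((H h hS).2.2.2 hT u ?_).1).1
  rw [edgeDist_diamond σ π hk, (H h hS).2.2.1 hk]
  simp [Strategy.ofChoice, Subtype.ext (hcu h rfl)]

/-- The moves after which the value is the same and can still not be undercut. -/
def safeMoves (G : StochasticGame V) (T : Set V) : G.Moves :=
  fun h u => h.snoc u.1 ∉ G.undercutRegion T ∧ G.value T (h.snoc u.1) = G.value T h

/-- The moves that do not change the value. -/
def preservingMoves (G : StochasticGame V) (T : Set V) : G.Moves :=
  fun h u => G.value T (h.snoc u.1) = G.value T h

/-- Restricting `□` to safe moves and `◇` to value-preserving ones does not decrease the value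
after a history where the value cannot be undercut: otherwise `◇` would undercut it by playing
optimally in the restricted game as long as `□` makes safe moves. -/
theorem value_le_restrictedValue (hG : G.FinitelyBranching) {h₀ : History V}
    (hh₀ : h₀ ∉ G.undercutRegion T) :
    G.value T h₀ ≤ restrictedValue T (G.safeMoves T) (G.preservingMoves T) h₀ := by
  classical
  set w := restrictedValue T (G.safeMoves T) (G.preservingMoves T) with hw
  have hc : ∀ h : History V, ∃ u : G.Succ h.last, h.last ∉ T → G.owner h.last = .diamond →
      G.value T (h.snoc u.1) = G.value T h ∧ w (h.snoc u.1) ≤ w h := by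
    intro h
    by_cases hh : h.last ∉ T ∧ G.owner h.last = .diamond
    · have : Finite {u : G.Succ h.last // G.value T (h.snoc u.1) = G.value T h} :=
        have : Finite (G.Succ h.last) := (hG h.last).to_subtype
        inferInstance
      obtain ⟨u, hu⟩ := exists_value_snoc_eq_of_diamond hG hh.1 hh.2
      have : Nonempty {u : G.Succ h.last // G.value T (h.snoc u.1) = G.value T h} := ⟨⟨u, hu⟩⟩
      obtain ⟨u, hu⟩ := Finite.exists_min
        fun u : {u : G.Succ h.last // G.value T (h.snoc u.1) = G.value T h} => w (h.snoc u.1.1)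
      refine ⟨u.1, fun _ _ => ⟨u.2, ?_⟩⟩
      rw [hw, restrictedValue_of_notMem T _ _ hG hh.1, bellman_diamond _ _ _ hh.2, ← hw]
      exact le_iInf₂ fun u' hu' => hu ⟨u', hu'⟩
    · obtain ⟨u⟩ : Nonempty (G.Succ h.last) := inferInstance
      exact ⟨u, fun h1 h2 => absurd ⟨h1, h2⟩ hh⟩
  choose c hc using hc
  obtain ⟨σ, π, S, hS, H⟩ := exists_play_attaining_value hG
    (valuePreserving_ofChoice (G := G) (T := T) c fun h h1 h2 => (hc h h1 h2).1) hh₀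
  rw [← (H h₀ hS).2.1]
  refine reachFrom_le_of_superharmonic T σ π S w
    (fun h _ hT => (restrictedValue_of_mem T _ _ hT).ge)
    (fun h hh hT u hu => ((H h hh).2.2.2 hT u hu).1) (fun h hh hT => ?_) hS
  obtain ⟨-, -, hπ, hstep⟩ := H h hh
  cases hk : G.owner h.last
  · refine PMF.tsum_mul_le _ fun u hu => ?_
    rw [hw, restrictedValue_of_notMem T _ _ hG hT, bellman_box _ _ _ hk]
    obtain ⟨huS, huv⟩ := hstep hT u hu
    exact le_iSup₂_of_le u ⟨(H _ huS).1, huv hk⟩ le_rfl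
  · rw [edgeDist_diamond σ π hk, hπ hk]
    simp only [Strategy.ofChoice, PMF.tsum_pure_mul]
    exact (hc h hT hk).2
  · rw [hw, restrictedValue_of_notMem T _ _ hG hT, bellman_circle _ _ _ hk, edgeDist_circle σ π hk]

end StochasticGame

namespace StochasticGame

variable {V : Type*} {G : StochasticGame V} {T : Set V}

/-! ### Attaining the value -/

lemma valueWithin_le_value (hG : G.FinitelyBranching) (n : ℕ) (h : History V) :
    valueWithin T (G.safeMoves T) (G.preservingMoves T) n h ≤ G.value T h := by
  induction n generalizing h with
  | zero =>
    by_cases hT : h.last ∈ T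
    · rw [valueWithin_of_mem _ _ _ hT, value_of_mem T hT]
    · simp [valueWithin_zero_of_notMem _ _ _ hT]
  | succ n ih =>
    by_cases hT : h.last ∈ T
    · rw [valueWithin_of_mem _ _ _ hT, value_of_mem T hT]
    rw [valueWithin_succ_of_notMem _ _ _ hT]
    cases hk : G.owner h.last
    · rw [bellman_box _ _ _ hk]
      exact iSup₂_le fun u hu => (ih _).trans hu.2.le
    · rw [bellman_diamond _ _ _ hk]
      obtain ⟨u, hu⟩ := exists_value_snoc_eq_of_diamond hG hT hk
      exact iInf₂_le_of_le u hu ((ih _).trans hu.le)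
    · rw [bellman_circle _ _ _ hk, value_of_circle hG hT hk]
      exact ENNReal.tsum_le_tsum fun u => mul_le_mul_right (ih _) _

lemma exists_half_value_le_valueWithin (hG : G.FinitelyBranching) {h : History V}
    (hh : h ∉ G.undercutRegion T) :
    ∃ n, G.value T h / 2 ≤
      valueWithin T (G.safeMoves T) (G.preservingMoves T) (n + 1) h := by
  by_cases h0 : G.value T h = 0
  · exact ⟨0, by simp [h0]⟩
  have hlt : G.value T h / 2 < G.value T h :=
    ENNReal.half_lt_self h0 (ne_top_of_le_ne_top ENNReal.one_ne_top (value_le_one T h))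
  obtain ⟨n, hn⟩ := lt_iSup_iff.1 (hlt.trans_le (value_le_restrictedValue hG hh))
  exact ⟨n, hn.le.trans (valueWithin_le_succ _ _ _ _ _)⟩

lemma exists_safeMove (hG : G.FinitelyBranching) (n : ℕ) {h : History V} (hT : h.last ∉ T)
    (hh : h ∉ G.undercutRegion T) (hk : G.owner h.last = .box) :
    ∃ u : G.Succ h.last, G.safeMoves T h u ∧
      valueWithin T (G.safeMoves T) (G.preservingMoves T) (n + 1) h ≤
        valueWithin T (G.safeMoves T) (G.preservingMoves T) n (h.snoc u.1) := by
  have : Finite (G.Succ h.last) := (hG h.last).to_subtype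
  obtain ⟨u, hu⟩ := exists_snoc_notMem_undercutRegion_of_box hG hT hh hk
  have : Nonempty {u : G.Succ h.last // G.safeMoves T h u} := ⟨⟨u, hu⟩⟩
  obtain ⟨u, hu⟩ := Finite.exists_max fun u : {u : G.Succ h.last // G.safeMoves T h u} =>
    valueWithin T (G.safeMoves T) (G.preservingMoves T) n (h.snoc u.1.1)
  refine ⟨u.1, u.2, ?_⟩
  rw [valueWithin_succ_of_notMem _ _ _ hT, bellman_box _ _ _ hk]
  exact iSup₂_le fun u' hu' => hu ⟨u', hu'⟩

/-- If the value cannot be undercut, then `□` has an optimal strategy. It plays in rounds: in each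
round it maximizes the restricted value for a horizon within which half of the current value is
attained, so that the part of the value that is not yet secured is halved in each round. As soon as
`◇` makes a move that increases the value, it secures the previous value instead. -/
theorem exists_value_le_reachFrom (hG : G.FinitelyBranching) {v : V}
    (hv : (⟨[], v⟩ : History V) ∉ G.undercutRegion T) :
    ∃ σ : G.Strategy .box, ∀ π : G.Strategy .diamond,
      G.value T ⟨[], v⟩ ≤ reachFrom T σ π ⟨[], v⟩ := by
  classical
  set w := valueWithin T (G.safeMoves T) (G.preservingMoves T) with hw
  have hr : ∀ h : History V, ∃ n, h ∉ G.undercutRegion T → G.value T h / 2 ≤ w (n + 1) h :=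
    fun h => by
      by_cases hh : h ∉ G.undercutRegion T
      · obtain ⟨n, hn⟩ := exists_half_value_le_valueWithin hG hh
        exact ⟨n, fun _ => hn⟩
      · exact ⟨0, fun h' => absurd h' hh⟩
  have hc : ∀ (n : ℕ) (h : History V), ∃ u : G.Succ h.last, h.last ∉ T →
      h ∉ G.undercutRegion T → G.owner h.last = .box →
      G.safeMoves T h u ∧ w (n + 1) h ≤ w n (h.snoc u.1) := fun n h => by
    by_cases hh : h.last ∉ T ∧ h ∉ G.undercutRegion T ∧ G.owner h.last = .box
    · obtain ⟨u, hu⟩ := exists_safeMove hG n hh.1 hh.2.1 hh.2.2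
      exact ⟨u, fun _ _ _ => hu⟩
    · obtain ⟨u⟩ : Nonempty (G.Succ h.last) := inferInstance
      exact ⟨u, fun h1 h2 h3 => absurd ⟨h1, h2, h3⟩ hh⟩
  have hτ : ∀ (h : History V) (u : V), ∃ τ : G.Strategy .box,
      G.value T h < G.value T (h.snoc u) →
        ∀ π, G.value T h < reachFrom T τ π (h.snoc u) := fun h u => by
    by_cases hh : G.value T h < G.value T (h.snoc u)
    · obtain ⟨τ, hτ⟩ := exists_lt_reachFrom_of_lt_value hG hh
      exact ⟨τ, fun _ => hτ⟩
    · obtain ⟨τ, -⟩ := exists_valueWithin_le hG T 0 h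
      exact ⟨τ, fun h' => absurd h' hh⟩
  choose r hr using hr
  choose c hc using hc
  choose τ hτ using hτ
  -- The memory is `inl k` if `k + 1` steps of the current round are left, and `inr ρ` if the
  -- strategy has been switched to `ρ` for good.
  set upd : ℕ ⊕ G.Strategy .box → History V → V → ℕ ⊕ G.Strategy .box := fun m h u =>
    m.elim
      (fun k => if G.owner h.last = .diamond ∧ G.value T h < G.value T (h.snoc u)
        then .inr (τ h u) else .inl (k.casesOn (r (h.snoc u)) fun k => k)) .inr with hupd
  set mode : History V → ℕ ⊕ G.Strategy .box :=
    History.memory (fun v => .inl (r ⟨[], v⟩)) upd with hmode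
  have mode_snoc (h : History V) (u : V) : mode (h.snoc u) = upd (mode h) h u :=
    History.memory_snoc _ _ h u
  set σ : G.Strategy .box := Strategy.switch fun h =>
    (mode h).elim (fun k => Strategy.ofChoice (c k)) id with hσ
  refine ⟨σ, fun π => ?_⟩
  have switched {h : History V} {u : V} {k : ℕ} (hm : mode h = .inl k)
      (hk : G.owner h.last = .diamond) (hlt : G.value T h < G.value T (h.snoc u)) :
      G.value T h ≤ reachFrom T σ π (h.snoc u) := by
    have hmu : mode (h.snoc u) = .inr (τ h u) := by simp [mode_snoc, hupd, hm, hk, hlt]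
    rw [hσ, reachFrom_switch_box T (τ := τ h u) {h' | mode h' = .inr (τ h u)}
      (fun h' (hh' : mode h' = _) => by simp [hh'])
      (fun h' (hh' : mode h' = _) u' => by simp [mode_snoc, hupd, hh']) hmu]
    exact (hτ h u hlt π).le
  have step {a b : ℝ≥0∞} (hab : a + b = 1) {k : ℕ} {h : History V} (hT : h.last ∉ T)
      (hh : h ∉ G.undercutRegion T) (hm : mode h = .inl k)
      (child : ∀ u : V, h.snoc u ∉ G.undercutRegion T →
        ¬(G.owner h.last = .diamond ∧ G.value T h < G.value T (h.snoc u)) →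
        a * G.value T (h.snoc u) + b * w k (h.snoc u) ≤ reachFrom T σ π (h.snoc u)) :
      a * G.value T h + b * w (k + 1) h ≤ reachFrom T σ π h := by
    cases hk : G.owner h.last
    · obtain ⟨⟨hu, huv⟩, huw⟩ := hc _ h hT hh hk
      rw [reachFrom_box T σ π hT hk]
      simp only [hσ, Strategy.switch, hm, Sum.elim_inl, Strategy.ofChoice, PMF.tsum_pure_mul]
      refine le_trans ?_ (child _ hu (by simp [hk]))
      rw [huv]
      gcongr
    · rw [reachFrom_diamond T σ π hT hk]
      refine PMF.le_tsum_mul _ fun u _ => ?_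
      rcases (le_value_snoc_of_diamond hG hT hk u).eq_or_lt with huv | hlt
      · have hu := snoc_notMem_undercutRegion_of_diamond hG hT hh hk u huv.symm
        refine le_trans ?_ (child u.1 hu (by simp [huv]))
        rw [← huv]
        gcongr
        rw [hw, valueWithin_succ_of_notMem _ _ _ hT, bellman_diamond _ _ _ hk]
        exact iInf₂_le u huv.symm
      · refine le_trans ?_ (switched hm hk hlt)
        calc _ ≤ a * G.value T h + b * G.value T h := by
              gcongr
              exact valueWithin_le_value hG _ _
          _ = G.value T h := by rw [← add_mul, hab, one_mul]
    · rw [reachFrom_circle T σ π hT hk, value_of_circle hG hT hk, hw,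
        valueWithin_succ_of_notMem _ _ _ hT, bellman_circle _ _ _ hk, ← hw,
        ← ENNReal.tsum_mul_left, ← ENNReal.tsum_mul_left, ← ENNReal.tsum_add]
      refine ENNReal.tsum_le_tsum fun u => ?_
      rw [mul_left_comm a, mul_left_comm b, ← mul_add]
      exact mul_le_mul_right (child u.1
        (snoc_notMem_undercutRegion_of_circle hG hT hh hk u) (by simp [hk])) _
  have secured {a b : ℝ≥0∞} (hab : a + b = 1) {h : History V} (hT : h.last ∈ T) (k : ℕ) :
      a * G.value T h + b * w k h ≤ reachFrom T σ π h := by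
    rw [value_of_mem T hT, hw, valueWithin_of_mem _ _ _ hT, reachFrom_of_mem T σ π hT,
      mul_one, mul_one, hab]
  -- If the fraction `a` of the value is secured at the start of each round, then this fraction of
  -- the value plus the remaining fraction of the chance to win in this round is secured throughout.
  have round {a b : ℝ≥0∞} (hab : a + b = 1)
      (hstart : ∀ h, h ∉ G.undercutRegion T → mode h = .inl (r h) →
        a * G.value T h ≤ reachFrom T σ π h) (k : ℕ) :
      ∀ h, h ∉ G.undercutRegion T → mode h = .inl k →
        a * G.value T h + b * w (k + 1) h ≤ reachFrom T σ π h := by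
    induction k with
    | zero =>
      intro h hh hm
      by_cases hT : h.last ∈ T
      · exact secured hab hT _
      refine step hab hT hh hm fun u hu hstay => ?_
      by_cases huT : u ∈ T
      · exact secured hab (h := h.snoc u) huT _
      rw [hw, valueWithin_zero_of_notMem _ _ _ (h := h.snoc u) huT, mul_zero, add_zero]
      exact hstart _ hu (by rw [mode_snoc, hm]; exact if_neg hstay)
    | succ k ih =>
      intro h hh hm
      by_cases hT : h.last ∈ T
      · exact secured hab hT _
      exact step hab hT hh hm fun u hu hstay =>
        ih _ hu (by rw [mode_snoc, hm]; exact if_neg hstay)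
  have start (j : ℕ) : ∃ a : ℝ≥0∞, a + 2⁻¹ ^ j = 1 ∧ ∀ h, h ∉ G.undercutRegion T →
      mode h = .inl (r h) → a * G.value T h ≤ reachFrom T σ π h := by
    induction j with
    | zero => exact ⟨0, by simp, by simp⟩
    | succ j ih =>
      obtain ⟨a, hab, ha⟩ := ih
      refine ⟨a + 2⁻¹ ^ (j + 1), ?_, fun h hh hm => le_trans ?_ (round hab ha _ h hh hm)⟩
      · rw [add_assoc, pow_succ, ← mul_add, ENNReal.inv_two_add_inv_two, mul_one, hab]
      · rw [add_mul, pow_succ, mul_assoc, mul_comm 2⁻¹, ← div_eq_mul_inv]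
        gcongr
        exact hr h hh
  have hlim : Filter.Tendsto (fun j : ℕ => reachFrom T σ π ⟨[], v⟩ + 2⁻¹ ^ j) Filter.atTop
      (nhds (reachFrom T σ π ⟨[], v⟩)) := by
    simpa using tendsto_const_nhds.add
      (ENNReal.tendsto_pow_atTop_nhds_zero_of_lt_one (r := 2⁻¹) (by simp))
  refine ge_of_tendsto' hlim fun j => ?_
  obtain ⟨a, hab, ha⟩ := start j
  calc G.value T ⟨[], v⟩ = a * G.value T ⟨[], v⟩ + 2⁻¹ ^ j * G.value T ⟨[], v⟩ := by
        rw [← add_mul, hab, one_mul]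
    _ ≤ reachFrom T σ π ⟨[], v⟩ + 2⁻¹ ^ j * 1 := by
        gcongr
        · exact ha _ hv (History.memory_root _ _ v)
        · exact value_le_one T _
    _ = _ := by rw [mul_one]

/-! ### Determinacy -/

/-- Comparing `ϱ` with the value decides every objective except `≥ ϱ` with `ϱ` equal to the value,
which depends on whether the value can be undercut. -/
theorem mem_winningRegionBox_or_mem_winningRegionDiamond [Countable V] (hG : G.FinitelyBranching)
    (T : Set V) (c : Comparison) {ϱ : ℝ} (hϱ : 0 ≤ ϱ) (v : V) :
    v ∈ G.winningRegionBox T c ϱ ∨ v ∈ G.winningRegionDiamond T c ϱ := by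
  set x : ℝ≥0∞ := ENNReal.ofReal ϱ with hx
  have hfin (σ : G.Strategy .box) (π : G.Strategy .diamond) : reachFrom T σ π ⟨[], v⟩ ≠ ∞ :=
    ne_top_of_le_ne_top ENNReal.one_ne_top (reachFrom_le_one T σ π _)
  have hgt (σ : G.Strategy .box) (π : G.Strategy .diamond) :
      Comparison.gt.Holds (reachProb σ π v T) ϱ ↔ x < reachFrom T σ π ⟨[], v⟩ := by
    rw [reachProb_eq_toReal_reachFrom, hx, ENNReal.ofReal_lt_iff_lt_toReal hϱ (hfin σ π)]; rfl
  have hge (σ : G.Strategy .box) (π : G.Strategy .diamond) :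
      Comparison.ge.Holds (reachProb σ π v T) ϱ ↔ x ≤ reachFrom T σ π ⟨[], v⟩ := by
    rw [reachProb_eq_toReal_reachFrom, hx, ENNReal.ofReal_le_iff_le_toReal (hfin σ π)]; rfl
  obtain ⟨π₀, hπ₀⟩ := exists_valuePreserving hG T
  rcases lt_trichotomy (G.value T ⟨[], v⟩) x with hlt | heq | hlt
  · refine Or.inr ⟨π₀, fun σ => ?_⟩
    have := (reachFrom_le_value σ hG hπ₀ ⟨[], v⟩).trans_lt hlt
    cases c
    · rw [hgt]; exact this.not_gt
    · rw [hge]; exact this.not_ge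
  · cases c
    · refine Or.inr ⟨π₀, fun σ => ?_⟩
      rw [hgt, ← heq]
      exact (reachFrom_le_value σ hG hπ₀ ⟨[], v⟩).not_gt
    · by_cases hv : (⟨[], v⟩ : History V) ∈ G.undercutRegion T
      · obtain ⟨π, hπ⟩ := hv
        refine Or.inr ⟨π, fun σ => ?_⟩
        rw [hge, ← heq]
        exact (hπ σ).not_ge
      · obtain ⟨σ, hσ⟩ := exists_value_le_reachFrom hG hv
        refine Or.inl ⟨σ, fun π => ?_⟩
        rw [hge, ← heq]
        exact hσ π
  · obtain ⟨σ, hσ⟩ := exists_lt_reachFrom_of_lt_value hG hlt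
    refine Or.inl ⟨σ, fun π => ?_⟩
    cases c
    · exact (hgt σ π).2 (hσ π)
    · exact (hge σ π).2 (hσ π).le

end StochasticGame

theorem mainTheorem4 {V : Type*} [Countable V] (G : StochasticGame V)
    (hG : G.FinitelyBranching) (T : Set V) (c : StochasticGame.Comparison) (ϱ : ℝ)
    (hϱ : ϱ ∈ Set.Icc (0 : ℝ) 1) :
    G.winningRegionBox T c ϱ ∪ G.winningRegionDiamond T c ϱ = Set.univ ∧
      Disjoint (G.winningRegionBox T c ϱ) (G.winningRegionDiamond T c ϱ) := by
  refine ⟨Set.eq_univ_of_forall fun v =>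
    StochasticGame.mem_winningRegionBox_or_mem_winningRegionDiamond hG T c hϱ.1 v,
    Set.disjoint_left.2 ?_⟩
  rintro v ⟨σ, hσ⟩ ⟨π, hπ⟩
  exact hπ σ (hσ π)
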